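/- For $z\in\mathbb Z$ let $e_z:[0,1)\to\mathbb C$, $e_z(x)=\exp(2\pi i z x)$; these are the trigonometric functions. For $j\in\{0,1,2,\dots\}$ let $r_j:[0,1)\to\{-1,1\}$ be the Rademacher function with $r_j(x)=1$ if and only if $2^jx-\lfloor 2^jx\rfloor<\frac12$, and for each finite $J\subset\{0,1,2,\dots\}$ let $w_J:[0,1)\to\mathbb C$, $w_J=\prod_{j\in J}r_j$; these are the Walsh functions. Let $L_p[0,1)$ be the complex Lebesgue space with respect to Lebesgue measure. Theorem. Let $1<p<\infty$ with $p\neq 2$, and let $\sigma$ be any bijection from the set of trigonometric functions onto the set of Walsh functions. Then $\sigma$ does not extend to an isomorphism $L_p[0,1)\to L_p[0,1)$; that is, there is no linear bijection $T:L_p[0,1)\to L_p[0,1)$, continuous with continuous inverse, such that $Tf=\sigma(f)$ for every trigonometric function $f$. -/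

import Mathlib

open MeasureTheory

noncomputable section

/-- The half-open unit interval `[0,1)`. -/
abbrev UnitIco : Type := Set.Ico (0 : ℝ) 1

/-- Lebesgue measure on `[0,1)`: the measure of `A` is the Lebesgue measure of `A` as a subset
of `ℝ`. -/
def lebIco : Measure UnitIco := (volume : Measure ℝ).comap Subtype.val

/-- The trigonometric function `e_z : [0,1) → ℂ`, `x ↦ exp(2πizx)`. -/
def trigFun (z : ℤ) (x : UnitIco) : ℂ :=
  Complex.exp (2 * Real.pi * Complex.I * z * ((x : ℝ) : ℂ))

/-- The Rademacher function `r_j`, `j = 0, 1, 2, …`: it takes the value `1` where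
`2^j x - ⌊2^j x⌋ < 1/2`, and `-1` elsewhere. -/
def rademacherFun (j : ℕ) (x : UnitIco) : ℂ :=
  if (2 : ℝ) ^ j * (x : ℝ) - ⌊(2 : ℝ) ^ j * (x : ℝ)⌋ < 1 / 2 then 1 else -1

/-- The Walsh function `w_J = ∏_{j ∈ J} r_j` for a finite set `J` of natural numbers. -/
def walshFun (J : Finset ℕ) (x : UnitIco) : ℂ :=
  ∏ j ∈ J, rademacherFun j x

/-- The set of all trigonometric functions on `[0,1)`. -/
def trigFunctions : Set (UnitIco → ℂ) := Set.range trigFun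

/-- The set of all Walsh functions on `[0,1)`. -/
def walshFunctions : Set (UnitIco → ℂ) := Set.range walshFun

/-- The complex Banach space `L_p[0,1)`, with respect to Lebesgue measure. -/
abbrev LpUnit (p : ENNReal) : Type := Lp ℂ p lebIco

instance isProbabilityMeasure_lebIco : IsProbabilityMeasure lebIco := by
  refine ⟨?_⟩
  rw [lebIco, comap_subtype_coe_apply measurableSet_Ico, Set.image_univ, Subtype.range_coe, Real.volume_Ico]
  simp

theorem memLp_of_mem_trigFunctions (p : ENNReal) {f : UnitIco → ℂ} (hf : f ∈ trigFunctions) :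
    MemLp f p lebIco := by
  obtain ⟨z, rfl⟩ := hf
  refine MemLp.of_bound (C := 1) ?_ (Filter.Eventually.of_forall fun x => ?_)
  · have : Continuous (trigFun z) := by unfold trigFun; fun_prop
    exact this.aestronglyMeasurable
  · have : 2 * (Real.pi : ℂ) * Complex.I * z * ((x : ℝ) : ℂ)
        = ((2 * Real.pi * z * (x : ℝ) : ℝ) : ℂ) * Complex.I := by push_cast; ring
    rw [trigFun, this, Complex.norm_exp_ofReal_mul_I]

theorem memLp_of_mem_walshFunctions (p : ENNReal) {f : UnitIco → ℂ} (hf : f ∈ walshFunctions) :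
    MemLp f p lebIco := by
  obtain ⟨J, rfl⟩ := hf
  refine MemLp.of_bound (C := 1) ?_ (Filter.Eventually.of_forall fun x => ?_)
  · have h : ∀ j, Measurable (rademacherFun j) := fun j => by
      unfold rademacherFun
      have hm : Measurable fun x : UnitIco => (2 : ℝ) ^ j * (x : ℝ) :=
        measurable_subtype_coe.const_mul _
      exact Measurable.ite (measurableSet_lt (measurable_fract.comp hm) measurable_const)
        measurable_const measurable_const
    have : Measurable (walshFun J) := by
      unfold walshFun
      exact Finset.measurable_prod J fun j _ => h j
    exact this.aestronglyMeasurable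
  · rw [walshFun, norm_prod]
    refine Finset.prod_le_one (fun _ _ => norm_nonneg _) fun j _ => ?_
    unfold rademacherFun
    split_ifs <;> simp

/-- The element of `L_p[0,1)` represented by a trigonometric function. -/
def trigToLp (p : ENNReal) (f : trigFunctions) : LpUnit p :=
  (memLp_of_mem_trigFunctions p f.2).toLp (f : UnitIco → ℂ)

/-- The element of `L_p[0,1)` represented by a Walsh function. -/
def walshToLp (p : ENNReal) (f : walshFunctions) : LpUnit p :=
  (memLp_of_mem_walshFunctions p f.2).toLp (f : UnitIco → ℂ)

/-- A map `σ` from the trigonometric functions to the Walsh functions extends to an isomorphism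
`L_p[0,1) → L_p[0,1)`, that is, to a linear bijection that is continuous in both directions. -/
def ExtendsToIsomorphism (p : ENNReal) [Fact (1 ≤ p)] (σ : trigFunctions → walshFunctions) : Prop :=
  ∃ T : LpUnit p ≃L[ℂ] LpUnit p, ∀ f : trigFunctions, T (trigToLp p f) = walshToLp p (σ f)

end

/-! ### Additive combinatorics: energy, small difference sets, and maps from groups of exponent two
to the integers. -/

section AdditiveCombinatorics

open Finset
open scoped Pointwise

/-! An isomorphism would give an injection `τ` from finite sets of indices to frequencies for which
Walsh sums and the matching trigonometric sums have comparable `p`-th moments. Test it on the first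
N = 2^n Walsh functions with coefficients w_J(x). The Walsh sum is then a Dirichlet kernel, equal to
N on a set of measure 1/N and 0 elsewhere. The trigonometric sum g_x is bounded by N, has second
moment N, and by comparison has `p`-th moment of order N^(p-1). As p ≠ 2, this forces g_x to be of
order N on a set of measure of order 1/N, hence ∫|g_x|^4 ≥ cN^3 (`exists_le_integral_pow_four`).

Averaging over x turns this into at least cN^3 quadruples that are additive both for symmetric
difference and, after `τ`, in the integers (`le_card_of_forall_le_integral_pow_four`). The graph of
`τ` thus has large additive energy, so a positive proportion B of it has small difference set
(`exists_large_subset_small_sub_of_energy`), and Plünnecke–Ruzsa gives |3B| = O(|B|). But doubling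
kills the first coordinate and not the second, so the sums x + 2y with x, y in B are all distinct
and |3B| ≥ |B|^2. Hence N is bounded (`exists_card_le_of_additive_quadruples`), which is absurd. -/

theorem card_mul_le_sq_of_forall_le_card_sub_eq {G : Type*} [AddCommGroup G] [DecidableEq G]
    (X Y : Finset G) (k : ℝ)
    (h : ∀ d ∈ Y, k ≤ (#{q ∈ X ×ˢ X | q.1 - q.2 = d} : ℝ)) : #Y * k ≤ (#X : ℝ) ^ 2 := by
  have h1 : #Y • k ≤ ∑ d ∈ Y, (#{q ∈ X ×ˢ X | q.1 - q.2 = d} : ℝ) :=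
    card_nsmul_le_sum Y _ k h
  have h2 : ∑ d ∈ Y, #{q ∈ X ×ˢ X | q.1 - q.2 = d} ≤ #(X ×ˢ X) := by
    rw [← card_biUnion]
    · exact card_le_card (biUnion_subset.2 fun _ _ => filter_subset _ _)
    · intro d _ e _ hde
      rw [Function.onFun, disjoint_filter]
      rintro q _ rfl
      exact hde
  rw [card_product] at h2
  rw [nsmul_eq_mul] at h1
  refine h1.trans ?_
  rw [sq]
  exact_mod_cast h2

/-- Dependent random choice: a dense graph on `A` has a neighbourhood most pairs of which have many
common neighbours. -/
theorem exists_large_subset_few_pairs_small_codegree {α : Type*} [DecidableEq α] (A : Finset α)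
    (hA : A.Nonempty) (r : α → α → Prop) [DecidableRel r] (δ ε : ℝ) (hδ : 0 ≤ δ) (hε : 0 < ε)
    (h : δ * (#A : ℝ) ^ 2 ≤ (#{q ∈ A ×ˢ A | r q.1 q.2} : ℝ)) :
    ∃ A' ⊆ A, δ ^ 2 / 2 * (#A : ℝ) ^ 2 ≤ (#A' : ℝ) ^ 2 ∧
      (#{q ∈ A' ×ˢ A' | (#{b ∈ A | r q.1 b ∧ r q.2 b} : ℝ) < ε * δ ^ 2 / 2 * #A} : ℝ)
        ≤ ε * (#A' : ℝ) ^ 2 := by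
  have hN : (0 : ℝ) < #A := by exact_mod_cast hA.card_pos
  set N : ℝ := (#A : ℝ) with hNdef
  set bad : Finset (α × α) :=
    {q ∈ A ×ˢ A | (#{b ∈ A | r q.1 b ∧ r q.2 b} : ℝ) < ε * δ ^ 2 / 2 * N} with hbad
  have hsum : ∑ b ∈ A, (#{a ∈ A | r a b} : ℝ) = (#{q ∈ A ×ˢ A | r q.1 q.2} : ℝ) := by
    have := sum_card_bipartiteAbove_eq_sum_card_bipartiteBelow (s := A) (t := A) r
    have h2 : #{q ∈ A ×ˢ A | r q.1 q.2} = ∑ a ∈ A, #(bipartiteAbove r A a) := by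
      rw [card_filter, sum_product]
      refine sum_congr rfl fun a _ => ?_
      rw [bipartiteAbove, card_filter]
    rw [h2, this]
    push_cast
    rfl
  have hsq : δ ^ 2 * N ^ 3 ≤ ∑ b ∈ A, (#{a ∈ A | r a b} : ℝ) ^ 2 := by
    have h1 := sq_sum_le_card_mul_sum_sq (s := A) (f := fun b => (#{a ∈ A | r a b} : ℝ))
    rw [hsum] at h1
    have h2 : (δ * N ^ 2) ^ 2 ≤ (#{q ∈ A ×ˢ A | r q.1 q.2} : ℝ) ^ 2 := by gcongr
    have h3 : N * (δ ^ 2 * N ^ 3) ≤ N * ∑ b ∈ A, (#{a ∈ A | r a b} : ℝ) ^ 2 :=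
      le_trans (by linarith) h1
    exact le_of_mul_le_mul_left h3 hN
  have hbadsum : ∑ b ∈ A, (#{q ∈ bad | r q.1 b ∧ r q.2 b} : ℝ) ≤ ε * δ ^ 2 / 2 * N ^ 3 := by
    have h1 := sum_card_bipartiteAbove_eq_sum_card_bipartiteBelow (s := bad) (t := A)
      (fun q b => r q.1 b ∧ r q.2 b)
    have h2 : ∑ b ∈ A, (#{q ∈ bad | r q.1 b ∧ r q.2 b} : ℝ)
        = ∑ q ∈ bad, (#{b ∈ A | r q.1 b ∧ r q.2 b} : ℝ) := by
      exact_mod_cast h1.symm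
    rw [h2]
    have h3 : ∑ q ∈ bad, (#{b ∈ A | r q.1 b ∧ r q.2 b} : ℝ)
        ≤ #bad • (ε * δ ^ 2 / 2 * N) :=
      sum_le_card_nsmul _ _ _ fun q hq => (mem_filter.1 hq).2.le
    have h4 : (#bad : ℝ) ≤ N ^ 2 := by
      have : #bad ≤ #A * #A := (card_filter_le _ _).trans_eq (card_product A A)
      rw [sq, hNdef]; exact_mod_cast this
    rw [nsmul_eq_mul] at h3
    calc _ ≤ _ := h3
      _ ≤ N ^ 2 * (ε * δ ^ 2 / 2 * N) := by gcongr
      _ = _ := by ring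
  -- Charging each bad pair 1/ε lets one averaging over b yield both conclusions: Cauchy–Schwarz
  -- gives at least δ²N³ for the squared degrees, and the charge costs at most half of that.
  obtain ⟨b, hb, hb'⟩ : ∃ b ∈ A, δ ^ 2 / 2 * N ^ 2 ≤
      (#{a ∈ A | r a b} : ℝ) ^ 2 - (#{q ∈ bad | r q.1 b ∧ r q.2 b} : ℝ) / ε := by
    refine exists_le_of_sum_le hA ?_
    rw [sum_const, nsmul_eq_mul, sum_sub_distrib, ← sum_div]
    have : (∑ b ∈ A, (#{q ∈ bad | r q.1 b ∧ r q.2 b} : ℝ)) / ε ≤ δ ^ 2 / 2 * N ^ 3 := by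
      rw [div_le_iff₀ hε]; linarith
    have h3 : N * (δ ^ 2 / 2 * N ^ 2) = δ ^ 2 / 2 * N ^ 3 := by ring
    rw [← hNdef, h3]
    linarith
  refine ⟨{a ∈ A | r a b}, filter_subset _ _, ?_, ?_⟩
  · have : 0 ≤ (#{q ∈ bad | r q.1 b ∧ r q.2 b} : ℝ) / ε := by positivity
    linarith
  · have h0 : 0 ≤ δ ^ 2 / 2 * N ^ 2 := by positivity
    have h1 : (#{q ∈ bad | r q.1 b ∧ r q.2 b} : ℝ) / ε ≤ (#{a ∈ A | r a b} : ℝ) ^ 2 := by linarith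
    rw [div_le_iff₀ hε, mul_comm] at h1
    refine le_trans (Nat.cast_le.2 (card_le_card ?_)) h1
    intro q hq
    simp only [mem_filter, mem_product, hbad] at hq ⊢
    tauto

/-- If almost all differences of pairs from `A` lie in `D`, then `A` has a large subset whose
difference set is controlled by `D`. -/
theorem exists_subset_card_sub_mul_le {G : Type*} [AddCommGroup G] [DecidableEq G]
    (A D : Finset G) (hA : A.Nonempty)
    (h : (#{q ∈ A ×ˢ A | q.1 - q.2 ∉ D} : ℝ) ≤ 1 / 16 * (#A : ℝ) ^ 2) :
    ∃ B ⊆ A, 3 / 4 * (#A : ℝ) ≤ #B ∧ (#(B - B) : ℝ) * (#A / 2) ≤ (#D : ℝ) ^ 2 := by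
  have hn0 : (0 : ℝ) < #A := by exact_mod_cast hA.card_pos
  set n : ℝ := (#A : ℝ) with hn
  -- By Markov's inequality at most n/4 elements are discarded. Any two survivors a, b share at
  -- least n/2 elements x with a - x and b - x both in `D`, so a - b = (a - x) - (b - x) has at
  -- least n/2 representations.
  set B : Finset G := {a ∈ A | (#{b ∈ A | a - b ∉ D} : ℝ) < n / 4} with hB
  refine ⟨B, filter_subset _ _, ?_, ?_⟩
  · set C : Finset G := {a ∈ A | ¬ (#{b ∈ A | a - b ∉ D} : ℝ) < n / 4} with hC
    have h1 : (#B : ℝ) + #C = n := by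
      rw [hn, hB, hC]; exact_mod_cast card_filter_add_card_filter_not (s := A) _
    have h2 : #C • (n / 4) ≤ ∑ a ∈ C, (#{b ∈ A | a - b ∉ D} : ℝ) :=
      card_nsmul_le_sum _ _ _ fun a ha => not_lt.1 (mem_filter.1 ha).2
    have h3 : ∑ a ∈ C, (#{b ∈ A | a - b ∉ D} : ℝ) ≤ ∑ a ∈ A, (#{b ∈ A | a - b ∉ D} : ℝ) :=
      sum_le_sum_of_subset_of_nonneg (filter_subset _ _) fun _ _ _ => by positivity
    have h4 : ∑ a ∈ A, (#{b ∈ A | a - b ∉ D} : ℝ) = (#{q ∈ A ×ˢ A | q.1 - q.2 ∉ D} : ℝ) := by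
      rw [card_filter, sum_product]
      simp only [card_filter]
      push_cast
      rfl
    rw [nsmul_eq_mul] at h2
    have h6 : n * (#C : ℝ) ≤ n * (n / 4) := by linarith [h2.trans (h3.trans (h4.trans_le h))]
    have := le_of_mul_le_mul_left h6 hn0
    linarith
  · refine card_mul_le_sq_of_forall_le_card_sub_eq D (B - B) (n / 2) ?_
    intro d hd
    obtain ⟨a, ha, b, hb, rfl⟩ := mem_sub.1 hd
    have h1 : n / 2 ≤ (#{x ∈ A | a - x ∈ D ∧ b - x ∈ D} : ℝ) := by
      have hsub : A ⊆ {x ∈ A | a - x ∈ D ∧ b - x ∈ D} ∪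
          ({x ∈ A | a - x ∉ D} ∪ {x ∈ A | b - x ∉ D}) := by
        intro x hx
        simp only [mem_union, mem_filter]
        tauto
      have h2 := (card_le_card hsub).trans
        ((card_union_le _ _).trans (Nat.add_le_add_left (card_union_le _ _) _))
      have h3 : n ≤ (#{x ∈ A | a - x ∈ D ∧ b - x ∈ D} : ℝ) +
          ((#{x ∈ A | a - x ∉ D} : ℝ) + (#{x ∈ A | b - x ∉ D} : ℝ)) := by
        rw [hn]; exact_mod_cast h2
      have h4 := (mem_filter.1 ha).2
      have h5 := (mem_filter.1 hb).2
      linarith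
    refine h1.trans (Nat.cast_le.2 (card_le_card_of_injOn (fun x => (a - x, b - x)) ?_ ?_))
    · intro x hx
      have hx := mem_filter.1 hx
      exact mem_filter.2 ⟨mem_product.2 hx.2, by simp⟩
    · intro x _ y _ hxy
      exact sub_right_injective (Prod.ext_iff.1 hxy).1

/-- A weak form of the Balog–Szemerédi–Gowers theorem. -/
theorem exists_large_subset_small_sub_of_energy {G : Type*} [AddCommGroup G] [DecidableEq G]
    (c : ℝ) (hc : 0 < c) :
    ∃ κ > (0 : ℝ), ∃ K : ℝ, ∀ A : Finset G, A.Nonempty →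
      c * (#A : ℝ) ^ 3 ≤ ∑ q ∈ A ×ˢ A, (#{s ∈ A ×ˢ A | s.1 - s.2 = q.1 - q.2} : ℝ) →
      ∃ B ⊆ A, B.Nonempty ∧ κ * #A ≤ #B ∧ (#(B - B) : ℝ) ≤ K * #B := by
  classical
  set δ : ℝ := c / 2 with hδ
  have hδ0 : 0 < δ := by positivity
  set η : ℝ := 1 / 16 * δ ^ 2 / 2 with hη
  have hη0 : 0 < η := by positivity
  -- Here 3/8 = 3/4 · 1/2: random choice keeps a proportion δ/2 of `A`, and pruning keeps 3/4 of
  -- that. With L = 1/δ²/η and |D'| ≤ NL, the second constant comes from |B - B| · n/2 ≤ (NL)², n ≥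
  -- δN/2 and N ≤ |B|/(3δ/8).
  refine ⟨3 / 8 * δ, by positivity, (1 / δ ^ 2 / η) ^ 2 * 2 / (3 / 8 * δ) / (δ / 2), ?_⟩
  intro A hA hE
  have hN : (0 : ℝ) < #A := by exact_mod_cast hA.card_pos
  set N : ℝ := (#A : ℝ) with hNdef
  let rep : G → ℝ := fun d => (#{s ∈ A ×ˢ A | s.1 - s.2 = d} : ℝ)
  have rep_le : ∀ d, rep d ≤ N := by
    intro d
    have : #{s ∈ A ×ˢ A | s.1 - s.2 = d} ≤ #A := by
      refine card_le_card_of_injOn Prod.fst (fun s hs => ?_) ?_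
      · exact (mem_product.1 (mem_filter.1 hs).1).1
      · intro s hs t ht hst
        have h1 := (mem_filter.1 hs).2
        have h2 := (mem_filter.1 ht).2
        refine Prod.ext hst ?_
        have : s.1 - s.2 = t.1 - t.2 := h1.trans h2.symm
        rw [hst] at this
        exact sub_right_injective this
    exact Nat.cast_le.2 this
  -- Popular differences. Unpopular ones contribute at most δN³, half the energy, so the graph a - b
  -- ∈ D is dense.
  set D : Finset G := {d ∈ A - A | δ * N ≤ rep d} with hD
  have hDcard : (#D : ℝ) ≤ N / δ := by
    have := card_mul_le_sq_of_forall_le_card_sub_eq A D (δ * N) fun d hd => (mem_filter.1 hd).2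
    rw [le_div_iff₀ hδ0]
    have h2 : N * (#D * δ) ≤ N * N := by rw [← hNdef] at this; linarith
    exact le_of_mul_le_mul_left h2 hN
  have hdense : δ * N ^ 2 ≤ (#{q ∈ A ×ˢ A | q.1 - q.2 ∈ D} : ℝ) := by
    have h1 : ∀ q ∈ A ×ˢ A, rep (q.1 - q.2) ≤ δ * N + N * (if q.1 - q.2 ∈ D then 1 else 0) := by
      intro q hq
      split_ifs with h
      · have := rep_le (q.1 - q.2)
        have : 0 ≤ δ * N := by positivity
        linarith
      · have hq' : q.1 - q.2 ∈ A - A := sub_mem_sub (mem_product.1 hq).1 (mem_product.1 hq).2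
        have : rep (q.1 - q.2) < δ * N := by
          by_contra hcon
          exact h (mem_filter.2 ⟨hq', not_lt.1 hcon⟩)
        linarith
    have h2 := hE.trans (sum_le_sum h1)
    rw [sum_add_distrib, sum_const, card_product, ← mul_sum] at h2
    rw [nsmul_eq_mul] at h2
    push_cast at h2
    rw [← hNdef, sum_boole] at h2
    have h3 : c = 2 * δ := by rw [hδ]; ring
    rw [h3] at h2
    have : N * (δ * N ^ 2) ≤ N * (#{q ∈ A ×ˢ A | q.1 - q.2 ∈ D} : ℝ) := by linarith
    exact le_of_mul_le_mul_left this hN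
  obtain ⟨A', hA'A, hA'card, hA'bad⟩ := exists_large_subset_few_pairs_small_codegree A hA
    (fun a b => a - b ∈ D) δ (1 / 16) hδ0.le (by norm_num) hdense
  rw [← hNdef, ← hη] at hA'bad
  rw [← hNdef] at hA'card
  set n : ℝ := (#A' : ℝ) with hn
  have hn' : δ / 2 * N ≤ n := by
    refine le_of_sq_le_sq ?_ (by positivity)
    refine le_trans ?_ hA'card
    rw [mul_pow, div_pow]
    gcongr
    norm_num
  have hn0 : 0 < n := lt_of_lt_of_le (by positivity) hn'
  -- A pair with at least ηN common neighbours has its difference in this set, whose size is only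
  -- O(N) because |D| = O(N).
  set D' : Finset G := {d ∈ A - A | η * N ≤ (#{q ∈ D ×ˢ D | q.1 - q.2 = d} : ℝ)} with hD'
  have hD'card : (#D' : ℝ) ≤ N * (1 / δ ^ 2 / η) := by
    have h1 := card_mul_le_sq_of_forall_le_card_sub_eq D D' (η * N) fun d hd => (mem_filter.1 hd).2
    have h2 : (#D : ℝ) ^ 2 ≤ (N / δ) ^ 2 := by gcongr
    have h3 : N * (#D' * η) ≤ N * (N * (1 / δ ^ 2)) := by
      have : (N / δ) ^ 2 = N * (N * (1 / δ ^ 2)) := by field_simp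
      linarith
    have h4 := le_of_mul_le_mul_left h3 hN
    rw [← mul_div_assoc, le_div_iff₀ hη0]
    exact h4
  have hgood : ∀ a ∈ A, ∀ b ∈ A, η * N ≤ (#{x ∈ A | a - x ∈ D ∧ b - x ∈ D} : ℝ) → a - b ∈ D' := by
    intro a ha b hb h
    refine mem_filter.2 ⟨sub_mem_sub ha hb, h.trans ?_⟩
    refine Nat.cast_le.2 (card_le_card_of_injOn (fun x => (a - x, b - x)) ?_ ?_)
    · intro x hx
      have hx := mem_filter.1 hx
      exact mem_filter.2 ⟨mem_product.2 hx.2, by simp⟩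
    · intro x _ y _ hxy
      exact sub_right_injective (Prod.ext_iff.1 hxy).1
  have hbad : (#{q ∈ A' ×ˢ A' | q.1 - q.2 ∉ D'} : ℝ) ≤ 1 / 16 * n ^ 2 := by
    refine (Nat.cast_le.2 (card_le_card fun q hq => ?_)).trans hA'bad
    rw [mem_filter] at hq ⊢
    have hq' := mem_product.1 hq.1
    exact ⟨hq.1, not_le.1 fun hle => hq.2 (hgood _ (hA'A hq'.1) _ (hA'A hq'.2) hle)⟩
  obtain ⟨B, hBA', hBcard, key⟩ := exists_subset_card_sub_mul_le A' D'
    (card_pos.1 (Nat.cast_pos.1 (hn ▸ hn0))) hbad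
  rw [← hn] at hBcard key
  have hB0 : (0 : ℝ) < #B := lt_of_lt_of_le (by positivity) hBcard
  have hBN : 3 / 8 * δ * N ≤ #B := by
    refine le_trans ?_ hBcard
    linarith
  refine ⟨B, hBA'.trans hA'A, card_pos.1 (by exact_mod_cast hB0), hBN, ?_⟩
  set L : ℝ := 1 / δ ^ 2 / η with hL
  have hL0 : 0 < L := by positivity
  rw [div_div, div_mul_eq_mul_div, le_div_iff₀ (by positivity)]
  have h1 : (#D' : ℝ) ^ 2 ≤ (N * L) ^ 2 := by gcongr
  have h2 : (#(B - B) : ℝ) * (δ / 2 * N) ≤ 2 * (N * L) ^ 2 := by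
    have : (#(B - B) : ℝ) * (δ / 2 * N) ≤ (#(B - B) : ℝ) * n := by gcongr
    linarith
  have h3 : N * ((#(B - B) : ℝ) * (δ / 2)) ≤ N * (2 * L ^ 2 * N) := by
    rw [mul_pow] at h2; linarith
  have h4 := le_of_mul_le_mul_left h3 hN
  have h5 : 2 * L ^ 2 * (3 / 8 * δ * N) ≤ 2 * L ^ 2 * #B := by gcongr
  have h6 : (#(B - B) : ℝ) * (δ / 2) * (3 / 8 * δ) ≤ 2 * L ^ 2 * N * (3 / 8 * δ) := by gcongr
  linarith

/-- An injective map from a group of exponent two to the integers is far from being additive. -/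
theorem exists_card_le_of_additive_quadruples {G : Type*} [AddCommGroup G] [DecidableEq G]
    (hG : ∀ g : G, g + g = 0) (c : ℝ) (hc : 0 < c) :
    ∃ K : ℝ, ∀ (S : Finset G) (τ : G → ℤ), Function.Injective τ →
      c * (#S : ℝ) ^ 3 ≤ ∑ q ∈ S ×ˢ S,
        (#{s ∈ S ×ˢ S | s.1 - s.2 = q.1 - q.2 ∧ τ s.1 - τ s.2 = τ q.1 - τ q.2} : ℝ) →
      (#S : ℝ) ≤ K := by
  obtain ⟨κ, hκ, K, hK⟩ := exists_large_subset_small_sub_of_energy (G := G × ℤ) c hc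
  -- The 0 covers empty `S`, where nothing is known about the sign of `K`.
  refine ⟨max 0 (K ^ 3 / κ), fun S τ hτ hE => ?_⟩
  obtain rfl | hS := S.eq_empty_or_nonempty
  · simp
  refine le_max_of_le_right ?_
  let φ : G ↪ G × ℤ := ⟨fun g => (g, τ g), fun g h hgh => (Prod.ext_iff.1 hgh).1⟩
  have hφ : ∀ g, φ g = (g, τ g) := fun _ => rfl
  have hrep : ∑ q ∈ S.map φ ×ˢ S.map φ,
      (#{s ∈ S.map φ ×ˢ S.map φ | s.1 - s.2 = q.1 - q.2} : ℝ) = ∑ q ∈ S ×ˢ S,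
        (#{s ∈ S ×ˢ S | s.1 - s.2 = q.1 - q.2 ∧ τ s.1 - τ s.2 = τ q.1 - τ q.2} : ℝ) := by
    simp only [card_filter, sum_product, sum_map, hφ, Prod.mk_sub_mk, Prod.mk.injEq]
  obtain ⟨B, hB, hBne, hBcard, hBB⟩ := hK (S.map φ) (hS.map) (by rw [hrep, card_map]; exact hE)
  rw [card_map] at hBcard
  have hB0 : (0 : ℝ) < #B := by exact_mod_cast hBne.card_pos
  have hmem : ∀ b ∈ B, b.2 = τ b.1 := by
    intro b hb
    obtain ⟨g, _, rfl⟩ := mem_map.1 (hB hb)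
    rfl
  have hpl : (#(3 • B) : ℝ) ≤ ((#(B - B) : ℝ) / #B) ^ 3 * #B := by
    have := pluennecke_ruzsa_inequality_nsmul_sub hBne B 3
    have h2 : ((#(3 • B) : ℚ≥0) : ℝ) ≤ ((((#(B - B) : ℚ≥0) / #B) ^ 3 * #B : ℚ≥0) : ℝ) := by
      exact_mod_cast this
    push_cast at h2
    exact h2
  have hlow : (#B : ℝ) * #B ≤ #(3 • B) := by
    have : #(B ×ˢ B) ≤ #(3 • B) := by
      -- The first coordinate of x + 2y is that of x, which determines x on the graph; the second
      -- then gives the value of `τ` at y, hence y by injectivity.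
      refine card_le_card_of_injOn (fun q => q.1 + (q.2 + q.2)) ?_ ?_
      · intro q hq
        have hq := mem_product.1 hq
        have h3 : 3 • B = B + (B + B) := by rw [succ_nsmul', two_nsmul]
        rw [h3]
        exact add_mem_add hq.1 (add_mem_add hq.2 hq.2)
      · rintro ⟨x, y⟩ hq ⟨x', y'⟩ hq' h
        have hq := mem_product.1 hq
        have hq' := mem_product.1 hq'
        simp only [Prod.ext_iff, Prod.fst_add, Prod.snd_add, hG, add_zero] at h hq hq' ⊢
        have e1 := hmem _ hq.1
        have e2 := hmem _ hq.2
        have e3 := hmem _ hq'.1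
        have e4 := hmem _ hq'.2
        have hx : x.2 = x'.2 := by rw [e1, e3, h.1]
        have hy : y.2 = y'.2 := by have := h.2; lia
        refine ⟨⟨h.1, hx⟩, hτ ?_, hy⟩
        rw [← e2, ← e4, hy]
    rw [card_product] at this
    exact_mod_cast this
  have h1 : (#B : ℝ) ≤ ((#(B - B) : ℝ) / #B) ^ 3 :=
    le_of_mul_le_mul_right (hlow.trans hpl) hB0
  have h2 : (#(B - B) : ℝ) / #B ≤ K := by rwa [div_le_iff₀ hB0]
  have h3 : ((#(B - B) : ℝ) / #B) ^ 3 ≤ K ^ 3 := by gcongr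
  rw [le_div_iff₀ hκ]
  linarith

end AdditiveCombinatorics

/-! ### Characters and orthogonality for the trigonometric and Walsh systems. -/

theorem integral_lebIco (F : ℝ → ℂ) : ∫ x, F (x : ℝ) ∂lebIco = ∫ x in (0 : ℝ)..1, F x := by
  rw [lebIco, integral_subtype_comap measurableSet_Ico F, integral_Ico_eq_integral_Ioc,
    intervalIntegral.integral_of_le zero_le_one]

theorem integral_trigFun (z : ℤ) : ∫ x, trigFun z x ∂lebIco = if z = 0 then 1 else 0 := by
  unfold trigFun
  rw [integral_lebIco fun x => Complex.exp (2 * Real.pi * Complex.I * z * (x : ℂ))]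
  split_ifs with h
  · simp [h]
  · have hc : (2 * Real.pi * Complex.I * z : ℂ) ≠ 0 := by
      have : (z : ℂ) ≠ 0 := by exact_mod_cast h
      exact mul_ne_zero Complex.two_pi_I_ne_zero this
    rw [integral_exp_mul_complex hc]
    have : (2 * Real.pi * Complex.I * z * ((1 : ℝ) : ℂ) : ℂ) = z * (2 * Real.pi * Complex.I) := by
      push_cast; ring
    rw [this, Complex.exp_int_mul_two_pi_mul_I]
    simp

theorem trigFun_mul (y z : ℤ) (x : UnitIco) : trigFun y x * trigFun z x = trigFun (y + z) x := by
  unfold trigFun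
  rw [← Complex.exp_add]
  push_cast
  ring_nf

theorem conj_trigFun (z : ℤ) (x : UnitIco) :
    (starRingEnd ℂ) (trigFun z x) = trigFun (-z) x := by
  unfold trigFun
  rw [← Complex.exp_conj]
  simp [Complex.conj_ofNat]

theorem norm_trigFun (z : ℤ) (x : UnitIco) : ‖trigFun z x‖ = 1 := by
  have h := Complex.mul_conj (trigFun z x)
  rw [conj_trigFun, trigFun_mul, add_neg_cancel] at h
  have h2 : Complex.normSq (trigFun z x) = 1 := by
    have h3 : trigFun 0 x = 1 := by simp [trigFun]
    rw [h3] at h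
    exact_mod_cast h.symm
  rw [Complex.norm_def, h2, Real.sqrt_one]

theorem continuous_trigFun (z : ℤ) : Continuous (trigFun z) := by
  unfold trigFun; fun_prop

theorem integrable_trigFun (z : ℤ) : Integrable (trigFun z) lebIco :=
  memLp_one_iff_integrable.1 (memLp_of_mem_trigFunctions 1 ⟨z, rfl⟩)

theorem integrable_walshFun (J : Finset ℕ) : Integrable (walshFun J) lebIco :=
  memLp_one_iff_integrable.1 (memLp_of_mem_walshFunctions 1 ⟨J, rfl⟩)

theorem rademacherFun_eq_one_or (j : ℕ) (x : UnitIco) :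
    rademacherFun j x = 1 ∨ rademacherFun j x = -1 := by
  unfold rademacherFun
  split_ifs <;> simp

theorem walshFun_eq_one_or (J : Finset ℕ) (x : UnitIco) :
    walshFun J x = 1 ∨ walshFun J x = -1 := by
  unfold walshFun
  induction J using Finset.induction_on with
  | empty => simp
  | insert j J hj ih =>
    rw [Finset.prod_insert hj]
    rcases ih with h | h <;> rcases rademacherFun_eq_one_or j x with h' | h' <;> simp [h, h']

theorem walshFun_mul_self (J : Finset ℕ) (x : UnitIco) : walshFun J x * walshFun J x = 1 := by
  rcases walshFun_eq_one_or J x with h | h <;> simp [h]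

theorem conj_walshFun (J : Finset ℕ) (x : UnitIco) :
    (starRingEnd ℂ) (walshFun J x) = walshFun J x := by
  rcases walshFun_eq_one_or J x with h | h <;> simp [h]

theorem norm_walshFun (J : Finset ℕ) (x : UnitIco) : ‖walshFun J x‖ = 1 := by
  rcases walshFun_eq_one_or J x with h | h <;> simp [h]

open scoped symmDiff in
theorem walshFun_mul (J K : Finset ℕ) (x : UnitIco) :
    walshFun J x * walshFun K x = walshFun (J ∆ K) x := by
  have hJ : walshFun J x = walshFun (J \ K) x * walshFun (J ∩ K) x := by
    unfold walshFun
    rw [mul_comm, Finset.prod_inter_mul_prod_sdiff]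
  have hK : walshFun K x = walshFun (K \ J) x * walshFun (J ∩ K) x := by
    unfold walshFun
    rw [Finset.inter_comm, mul_comm, Finset.prod_inter_mul_prod_sdiff]
  have hJK : walshFun (J ∆ K) x = walshFun (J \ K) x * walshFun (K \ J) x := by
    unfold walshFun
    rw [symmDiff_def, Finset.sup_eq_union, Finset.prod_union disjoint_sdiff_sdiff]
  rw [hJ, hK, hJK]
  linear_combination (walshFun (J \ K) x * walshFun (K \ J) x) * walshFun_mul_self (J ∩ K) x

/-- The half-period shift of the lowest Rademacher factor changes the sign of a Walsh function. -/
theorem integral_walshFun_eq_zero (J : Finset ℕ) (hJ : J.Nonempty) :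
    ∫ x, walshFun J x ∂lebIco = 0 := by
  let R : ℕ → ℝ → ℂ := fun j x => if Int.fract ((2 : ℝ) ^ j * x) < 1 / 2 then 1 else -1
  let F : ℝ → ℂ := fun x => ∏ j ∈ J, R j x
  have hF : ∫ x, walshFun J x ∂lebIco = ∫ x in (0 : ℝ)..1, F x := integral_lebIco F
  have hR : ∀ j x, ∀ k : ℕ, R j (x + k / 2 ^ j) = R j x := by
    intro j x k
    simp only [R]
    rw [mul_add, mul_div_cancel₀ _ (by positivity : (2 : ℝ) ^ j ≠ 0), Int.fract_add_natCast]
  have hper : Function.Periodic F 1 := by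
    intro x
    refine Finset.prod_congr rfl fun j _ => ?_
    have := hR j x (2 ^ j)
    rwa [Nat.cast_pow, Nat.cast_ofNat, div_self (by positivity)] at this
  set m := J.min' hJ with hm
  set s : ℝ := 1 / 2 ^ (m + 1) with hs
  have hflip : ∀ x, R m (x + s) = - R m x := by
    intro x
    simp only [R]
    have h1 : (2 : ℝ) ^ m * (x + s) = 2 ^ m * x + 1 / 2 := by
      rw [hs, mul_add, pow_succ]; field_simp
    rw [h1]
    set y := (2 : ℝ) ^ m * x
    have h0 := Int.fract_nonneg y
    have h2 := Int.fract_lt_one y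
    by_cases h : Int.fract y < 1 / 2
    · have : Int.fract (y + 1 / 2) = Int.fract y + 1 / 2 := by
        rw [Int.fract_eq_iff]
        refine ⟨by linarith, by linarith, ⌊y⌋, ?_⟩
        rw [Int.fract]; ring
      rw [if_pos h, if_neg (by rw [this]; linarith)]
    · have : Int.fract (y + 1 / 2) = Int.fract y - 1 / 2 := by
        rw [Int.fract_eq_iff]
        refine ⟨by linarith, by linarith, ⌊y⌋ + 1, ?_⟩
        rw [Int.fract]; push_cast; ring
      rw [if_neg h, if_pos (by rw [this]; linarith), neg_neg]
  have hFs : ∀ x, F (x + s) = - F x := by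
    intro x
    simp only [F]
    have hmJ := J.min'_mem hJ
    rw [← Finset.mul_prod_erase J _ hmJ, ← Finset.mul_prod_erase J (fun j => R j x) hmJ, hflip,
      neg_mul]
    congr 2
    refine Finset.prod_congr rfl fun j hj => ?_
    have hlt : m < j := lt_of_le_of_ne (J.min'_le j (Finset.mem_of_mem_erase hj))
      (Finset.ne_of_mem_erase hj).symm
    obtain ⟨k, rfl⟩ := Nat.exists_eq_add_of_lt hlt
    -- For j = m + k + 1 the shift is 2^k whole periods of r_j, so the higher factors do not change.
    have : s = ((2 ^ k : ℕ) : ℝ) / 2 ^ (m + k + 1) := by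
      rw [hs]; push_cast; field_simp; ring
    rw [this, hR]
  have h1 : ∫ x in (0 : ℝ)..1, F (x + s) = ∫ x in (0 : ℝ)..1, F x := by
    rw [intervalIntegral.integral_comp_add_right]
    have := hper.intervalIntegral_add_eq s 0
    rw [zero_add] at this
    rw [zero_add, add_comm 1 s, this]
  simp only [hFs, intervalIntegral.integral_neg] at h1
  rw [hF]
  exact self_eq_neg.1 h1.symm

theorem integral_walshFun (J : Finset ℕ) :
    ∫ x, walshFun J x ∂lebIco = if J = ∅ then 1 else 0 := by
  split_ifs with h
  · simp [h, walshFun]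
  · exact integral_walshFun_eq_zero J (Finset.nonempty_iff_ne_empty.2 h)

theorem walshFun_injective : Function.Injective walshFun := by
  intro J K h
  have h1 : ∫ x, walshFun (symmDiff J K) x ∂lebIco = 1 := by
    simp only [← walshFun_mul, h, walshFun_mul_self]
    simp
  rw [integral_walshFun] at h1
  by_contra hne
  rw [if_neg (fun h0 : symmDiff J K = ∅ => hne (symmDiff_eq_bot.1 h0))] at h1
  exact zero_ne_one h1

/-- Frequencies may repeat, so the formula serves both for second moments, with frequencies `τ J`,
and for fourth moments, with frequencies `τ J - τ K` indexed by pairs. -/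
theorem integral_norm_sq_trig_sum {ι : Type*} (s : Finset ι) (a : ι → ℂ) (k : ι → ℤ) :
    ((∫ t, ‖∑ i ∈ s, a i * trigFun (k i) t‖ ^ 2 ∂lebIco : ℝ) : ℂ) =
      ∑ i ∈ s, ∑ j ∈ s, a i * (starRingEnd ℂ) (a j) * (if k i = k j then 1 else 0) := by
  rw [← integral_complex_ofReal]
  have h : ∀ t, ((‖∑ i ∈ s, a i * trigFun (k i) t‖ ^ 2 : ℝ) : ℂ) =
      ∑ i ∈ s, ∑ j ∈ s, a i * (starRingEnd ℂ) (a j) * trigFun (k i - k j) t := by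
    intro t
    push_cast
    rw [← Complex.mul_conj', map_sum, Finset.sum_mul_sum]
    refine Finset.sum_congr rfl fun i _ => Finset.sum_congr rfl fun j _ => ?_
    rw [map_mul, conj_trigFun, sub_eq_add_neg, ← trigFun_mul]
    ring
  simp only [h]
  rw [integral_finsetSum _ fun i _ => integrable_finsetSum _ fun j _ =>
    (integrable_trigFun _).const_mul _]
  refine Finset.sum_congr rfl fun i _ => ?_
  rw [integral_finsetSum _ fun j _ => (integrable_trigFun _).const_mul _]
  refine Finset.sum_congr rfl fun j _ => ?_
  rw [integral_const_mul, integral_trigFun]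
  simp only [sub_eq_zero]

/-! ### Norms in L_p as integrals. -/

theorem Lp_coeFn_sum_smul_toLp {α ι : Type*} [MeasurableSpace α] {μ : Measure α} {p : ENNReal}
    (s : Finset ι) (a : ι → ℂ) (φ : ι → α → ℂ) (hφ : ∀ i, MemLp (φ i) p μ) :
    (∑ i ∈ s, a i • (hφ i).toLp (φ i) : Lp ℂ p μ) =ᵐ[μ] fun t => ∑ i ∈ s, a i * φ i t := by
  classical
  induction s using Finset.induction_on with
  | empty =>
    simp only [Finset.sum_empty]
    exact Lp.coeFn_zero ℂ p μ
  | insert i s hi ih =>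
    rw [Finset.sum_insert hi]
    filter_upwards [Lp.coeFn_add (a i • (hφ i).toLp (φ i)) (∑ i ∈ s, a i • (hφ i).toLp (φ i)), ih,
      Lp.coeFn_smul (a i) ((hφ i).toLp (φ i)), (hφ i).coeFn_toLp] with t h1 h2 h3 h4
    rw [h1, Pi.add_apply, h2, h3, Pi.smul_apply, h4, Finset.sum_insert hi, smul_eq_mul]

theorem Lp_norm_rpow_eq_integral {α : Type*} [MeasurableSpace α] {μ : Measure α} {p : ENNReal}
    (hp0 : p ≠ 0) (hp : p ≠ ⊤) (G : Lp ℂ p μ) (g : α → ℂ) (h : G =ᵐ[μ] g) :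
    ‖G‖ ^ p.toReal = ∫ t, ‖g t‖ ^ p.toReal ∂μ := by
  have hpos := ENNReal.toReal_pos hp0 hp
  have h0 : 0 ≤ ∫ t, ‖G t‖ ^ p.toReal ∂μ := integral_nonneg fun _ => by positivity
  rw [Lp.norm_def, (Lp.memLp G).eLpNorm_eq_integral_rpow_norm hp0 hp,
    ENNReal.toReal_ofReal (by positivity), ← Real.rpow_mul h0, inv_mul_cancel₀ hpos.ne',
    Real.rpow_one]
  refine integral_congr_ae ?_
  filter_upwards [h] with t ht
  rw [ht]

/-! ### Comparison of moments. -/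

/-- If the `p`-th moment of a function with values in `[0,1]` is comparable to its second moment,
then so is its fourth moment. -/
theorem exists_le_integral_pow_four (p : ℝ) (hp : 1 < p) (hp2 : p ≠ 2) (C : ℝ) (hC : 0 < C) :
    ∃ c > (0 : ℝ), ∀ {α : Type} [MeasurableSpace α] (μ : Measure α) [IsProbabilityMeasure μ]
      (v : α → ℝ) (ε : ℝ), AEStronglyMeasurable v μ → (∀ t, 0 ≤ v t) → (∀ t, v t ≤ 1) →
      ∫ t, v t ^ 2 ∂μ = ε → ∫ t, v t ^ p ∂μ ≤ C * ε → ε ≤ C * ∫ t, v t ^ p ∂μ →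
      c * ε ≤ ∫ t, v t ^ 4 ∂μ := by
  have intpow : ∀ {α : Type} [MeasurableSpace α] (μ : Measure α) [IsProbabilityMeasure μ]
      (v : α → ℝ), AEStronglyMeasurable v μ → (∀ t, 0 ≤ v t) → (∀ t, v t ≤ 1) →
      ∀ q : ℝ, 0 < q → Integrable (fun t => v t ^ q) μ := by
    intro α _ μ _ v hm h0 h1 q hq
    refine Integrable.of_bound (C := 1)
      ((Real.continuous_rpow_const hq.le).comp_aestronglyMeasurable hm) ?_
    refine Filter.Eventually.of_forall fun t => ?_
    rw [Real.norm_of_nonneg (Real.rpow_nonneg (h0 t) q)]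
    exact Real.rpow_le_one (h0 t) (h1 t) hq.le
  rcases lt_or_gt_of_ne hp2 with hlt | hgt
  -- The threshold makes C·b^(2-p) = 1/2, so the part where v ≤ b contributes at most half of the
  -- second moment; where v > b, v² ≤ b⁻²v⁴.
  · set b : ℝ := (1 / (2 * C)) ^ (1 / (2 - p)) with hb
    have hb0 : 0 < b := by positivity
    have hbp : b ^ (2 - p) = 1 / (2 * C) := by
      rw [hb, ← Real.rpow_mul (by positivity), one_div_mul_cancel (by linarith), Real.rpow_one]
    refine ⟨b ^ 2 / 2, by positivity, ?_⟩
    intro α _ μ _ v ε hm h0 h1 h2 hpC _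
    have hpt : ∀ t, v t ^ 2 ≤ b ^ (2 - p) * v t ^ p + (b ^ 2)⁻¹ * v t ^ 4 := by
      intro t
      have hv := h0 t
      rcases le_or_gt (v t) b with h | h
      · have : v t ^ 2 = v t ^ (2 - p) * v t ^ p := by
          rw [← Real.rpow_add_of_nonneg hv (by linarith) (by linarith), sub_add_cancel,
            Real.rpow_two]
        have h3 : v t ^ (2 - p) ≤ b ^ (2 - p) := Real.rpow_le_rpow hv h (by linarith)
        have h4 : 0 ≤ (b ^ 2)⁻¹ * v t ^ 4 := by positivity
        have h5 := mul_le_mul_of_nonneg_right h3 (Real.rpow_nonneg hv p)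
        linarith
      · have h3 : 0 ≤ b ^ (2 - p) * v t ^ p := by positivity
        have h4 : v t ^ 2 ≤ (b ^ 2)⁻¹ * v t ^ 4 := by
          rw [inv_mul_eq_div, le_div_iff₀ (by positivity)]
          have : b ^ 2 ≤ v t ^ 2 := by gcongr
          nlinarith [sq_nonneg (v t)]
        linarith
    have i2 := intpow μ v hm h0 h1 2 (by norm_num)
    have ip := intpow μ v hm h0 h1 p (by linarith)
    have i4 := intpow μ v hm h0 h1 4 (by norm_num)
    simp only [Real.rpow_ofNat] at i2 i4
    have := integral_mono i2 ((ip.const_mul (b ^ (2 - p))).add (i4.const_mul (b ^ 2)⁻¹)) hpt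
    simp only [Pi.add_apply] at this
    rw [integral_add (ip.const_mul _) (i4.const_mul _), integral_const_mul, integral_const_mul,
      h2, hbp] at this
    have h6 : 1 / (2 * C) * ∫ t, v t ^ p ∂μ ≤ ε / 2 := by
      rw [one_div, inv_mul_le_iff₀ (by positivity)]
      linarith
    have h7 : ε / 2 ≤ (b ^ 2)⁻¹ * ∫ t, v t ^ 4 ∂μ := by linarith
    rw [inv_mul_eq_div, le_div_iff₀ (by positivity)] at h7
    linarith
  -- The second and `p`-th moments exchange roles. Where v > b, the crude bound v^p ≤ 1 ≤ b⁻⁴v⁴ also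
  -- covers p > 4.
  · set b : ℝ := (1 / (2 * C)) ^ (1 / (p - 2)) with hb
    have hb0 : 0 < b := by positivity
    have hbp : b ^ (p - 2) = 1 / (2 * C) := by
      rw [hb, ← Real.rpow_mul (by positivity), one_div_mul_cancel (by linarith), Real.rpow_one]
    refine ⟨b ^ 4 / (2 * C), by positivity, ?_⟩
    intro α _ μ _ v ε hm h0 h1 h2 _ hpC
    have hpt : ∀ t, v t ^ p ≤ b ^ (p - 2) * v t ^ 2 + (b ^ 4)⁻¹ * v t ^ 4 := by
      intro t
      have hv := h0 t
      rcases le_or_gt (v t) b with h | h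
      · have : v t ^ p = v t ^ (p - 2) * v t ^ 2 := by
          rw [← Real.rpow_two, ← Real.rpow_add_of_nonneg hv (by linarith) (by linarith),
            sub_add_cancel]
        have h3 : v t ^ (p - 2) ≤ b ^ (p - 2) := Real.rpow_le_rpow hv h (by linarith)
        have h4 : 0 ≤ (b ^ 4)⁻¹ * v t ^ 4 := by positivity
        have h5 := mul_le_mul_of_nonneg_right h3 (sq_nonneg (v t))
        linarith
      · have h3 : 0 ≤ b ^ (p - 2) * v t ^ 2 := by positivity
        have h4 : v t ^ p ≤ (b ^ 4)⁻¹ * v t ^ 4 := by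
          rw [inv_mul_eq_div, le_div_iff₀ (by positivity)]
          have h5 : b ^ 4 ≤ v t ^ 4 := by gcongr
          have h6 : v t ^ p ≤ 1 := Real.rpow_le_one hv (h1 t) (by linarith)
          calc v t ^ p * b ^ 4 ≤ 1 * b ^ 4 := by gcongr
            _ ≤ _ := by rwa [one_mul]
        linarith
    have i2 := intpow μ v hm h0 h1 2 (by norm_num)
    have ip := intpow μ v hm h0 h1 p (by linarith)
    have i4 := intpow μ v hm h0 h1 4 (by norm_num)
    simp only [Real.rpow_ofNat] at i2 i4
    have := integral_mono ip ((i2.const_mul (b ^ (p - 2))).add (i4.const_mul (b ^ 4)⁻¹)) hpt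
    simp only [Pi.add_apply] at this
    rw [integral_add (i2.const_mul _) (i4.const_mul _), integral_const_mul, integral_const_mul,
      h2, hbp] at this
    have h6 : C * ∫ t, v t ^ p ∂μ ≤ C * (1 / (2 * C) * ε + (b ^ 4)⁻¹ * ∫ t, v t ^ 4 ∂μ) := by
      gcongr
    have h7 : C * (1 / (2 * C) * ε + (b ^ 4)⁻¹ * ∫ t, v t ^ 4 ∂μ)
        = ε / 2 + C / b ^ 4 * ∫ t, v t ^ 4 ∂μ := by field_simp
    have h8 : ε / 2 ≤ C / b ^ 4 * ∫ t, v t ^ 4 ∂μ := by linarith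
    rw [div_mul_eq_mul_div, le_div_iff₀ (by positivity)] at h8
    rw [div_mul_eq_mul_div, div_le_iff₀ (by positivity)]
    linarith

/-! ### The Walsh–Dirichlet kernel. -/

/-- The Walsh–Dirichlet kernel of the first `2 ^ n` Walsh functions. -/
theorem sum_walshFun_mul_walshFun (n : ℕ) (x t : UnitIco) :
    (∑ J ∈ (Finset.range n).powerset, walshFun J x * walshFun J t) = 0 ∨
      (∑ J ∈ (Finset.range n).powerset, walshFun J x * walshFun J t) = 2 ^ n := by
  have h : (∑ J ∈ (Finset.range n).powerset, walshFun J x * walshFun J t) =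
      ∏ j ∈ Finset.range n, (1 + rademacherFun j x * rademacherFun j t) := by
    rw [Finset.prod_one_add]
    refine Finset.sum_congr rfl fun J _ => ?_
    rw [walshFun, walshFun, Finset.prod_mul_distrib]
  rw [h]
  by_cases h0 : ∃ j ∈ Finset.range n, 1 + rademacherFun j x * rademacherFun j t = 0
  · obtain ⟨j, hj, hj0⟩ := h0
    exact Or.inl (Finset.prod_eq_zero hj hj0)
  · push Not at h0
    right
    rw [Finset.prod_congr rfl (g := fun _ => (2 : ℂ))]
    · simp
    · intro j hj
      have := h0 j hj
      rcases rademacherFun_eq_one_or j x with h1 | h1 <;>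
        rcases rademacherFun_eq_one_or j t with h2 | h2 <;> simp [h1, h2] at this ⊢ <;> norm_num

/-- The kernel D takes only the values 0 and N = 2^n, so |D|^q = N^(q-1)·D pointwise, and D has
integral 1. -/
theorem integral_norm_rpow_walsh_kernel (q : ℝ) (hq : 0 < q) (n : ℕ) (x : UnitIco) :
    ∫ t, ‖∑ J ∈ (Finset.range n).powerset, walshFun J x * walshFun J t‖ ^ q ∂lebIco =
      (2 ^ n : ℝ) ^ q / 2 ^ n := by
  have hpt : ∀ t, ((‖∑ J ∈ (Finset.range n).powerset, walshFun J x * walshFun J t‖ ^ q : ℝ) : ℂ) =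
      (((2 ^ n : ℝ) ^ q / 2 ^ n : ℝ) : ℂ) *
        ∑ J ∈ (Finset.range n).powerset, walshFun J x * walshFun J t := by
    intro t
    rcases sum_walshFun_mul_walshFun n x t with h | h
    · rw [h, norm_zero, Real.zero_rpow hq.ne']; simp
    · rw [h]
      have h2 : ‖(2 ^ n : ℂ)‖ = 2 ^ n := by simp
      rw [h2]
      push_cast
      field_simp
  have hint : ∫ t, (∑ J ∈ (Finset.range n).powerset, walshFun J x * walshFun J t) ∂lebIco = 1 := by
    rw [integral_finsetSum _ fun J _ => (integrable_walshFun J).const_mul _]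
    simp only [integral_const_mul, integral_walshFun]
    rw [Finset.sum_eq_single ∅]
    · simp [walshFun]
    · intro J _ hJ; simp [hJ]
    · intro h; simp at h
  have h := integral_complex_ofReal (μ := lebIco)
    (f := fun t => ‖∑ J ∈ (Finset.range n).powerset, walshFun J x * walshFun J t‖ ^ q)
  simp only [hpt, integral_const_mul, hint, mul_one] at h
  exact_mod_cast h.symm

/-! ### Transfer of moments through the isomorphism, and moments of twisted sums. -/

theorem ExtendsToIsomorphism.exists_integral_comparison {p : ENNReal} [Fact (1 ≤ p)] (hp : p ≠ ⊤)
    {σ : trigFunctions → walshFunctions} (hσ : Function.Bijective σ)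
    (h : ExtendsToIsomorphism p σ) :
    ∃ τ : Finset ℕ → ℤ, Function.Injective τ ∧ ∃ C > (0 : ℝ),
      ∀ (s : Finset (Finset ℕ)) (a : Finset ℕ → ℂ),
        ∫ t, ‖∑ J ∈ s, a J * walshFun J t‖ ^ p.toReal ∂lebIco
          ≤ C * ∫ t, ‖∑ J ∈ s, a J * trigFun (τ J) t‖ ^ p.toReal ∂lebIco ∧
        ∫ t, ‖∑ J ∈ s, a J * trigFun (τ J) t‖ ^ p.toReal ∂lebIco
          ≤ C * ∫ t, ‖∑ J ∈ s, a J * walshFun J t‖ ^ p.toReal ∂lebIco := by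
  obtain ⟨T, hT⟩ := h
  have hp0 : p ≠ 0 := (zero_lt_one.trans_le (Fact.out : (1 : ENNReal) ≤ p)).ne'
  -- A right inverse of `σ`; `τ J` is a frequency of the trigonometric function it assigns to w_J.
  choose u hu using hσ.2
  have hex : ∀ J : Finset ℕ, ∃ z, trigFun z = u ⟨walshFun J, J, rfl⟩ := fun J => (u _).2
  choose τ hτ using hex
  have hW : ∀ J, MemLp (walshFun J) p lebIco := fun J => memLp_of_mem_walshFunctions p ⟨J, rfl⟩
  have hE : ∀ J, MemLp (trigFun (τ J)) p lebIco := fun J =>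
    memLp_of_mem_trigFunctions p ⟨τ J, rfl⟩
  have hTJ : ∀ J, T ((hE J).toLp (trigFun (τ J))) = (hW J).toLp (walshFun J) := by
    intro J
    have h1 := hT (u ⟨walshFun J, J, rfl⟩)
    rw [hu] at h1
    have h2 : trigToLp p (u ⟨walshFun J, J, rfl⟩) = (hE J).toLp (trigFun (τ J)) := by
      unfold trigToLp
      congr 1
      exact (hτ J).symm
    rw [h2] at h1
    exact h1
  refine ⟨τ, ?_, ‖(T : LpUnit p →L[ℂ] LpUnit p)‖ ^ p.toReal +
    ‖(T.symm : LpUnit p →L[ℂ] LpUnit p)‖ ^ p.toReal + 1, by positivity, ?_⟩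
  · intro J K hJK
    have h1 : u ⟨walshFun J, J, rfl⟩ = u ⟨walshFun K, K, rfl⟩ := by
      apply Subtype.ext
      rw [← hτ, ← hτ, hJK]
    have h2 := congrArg σ h1
    rw [hu, hu] at h2
    exact walshFun_injective (congrArg Subtype.val h2)
  · intro s a
    set g : LpUnit p := ∑ J ∈ s, a J • (hE J).toLp (trigFun (τ J)) with hg
    set f : LpUnit p := ∑ J ∈ s, a J • (hW J).toLp (walshFun J) with hf
    have hTg : T g = f := by
      rw [hg, hf, map_sum]
      refine Finset.sum_congr rfl fun J _ => ?_
      rw [map_smul, hTJ]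
    have hgn := Lp_norm_rpow_eq_integral hp0 hp g _ (Lp_coeFn_sum_smul_toLp s a _ hE)
    have hfn := Lp_norm_rpow_eq_integral hp0 hp f _ (Lp_coeFn_sum_smul_toLp s a _ hW)
    rw [← hgn, ← hfn]
    have h1 : ‖f‖ ≤ ‖(T : LpUnit p →L[ℂ] LpUnit p)‖ * ‖g‖ := by
      rw [← hTg]; exact (T : LpUnit p →L[ℂ] LpUnit p).le_opNorm g
    have h2 : ‖g‖ ≤ ‖(T.symm : LpUnit p →L[ℂ] LpUnit p)‖ * ‖f‖ := by
      have := (T.symm : LpUnit p →L[ℂ] LpUnit p).le_opNorm f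
      rwa [← hTg, ContinuousLinearEquiv.coe_coe, T.symm_apply_apply, hTg] at this
    have h3 := Real.rpow_le_rpow (norm_nonneg _) h1 (ENNReal.toReal_nonneg (a := p))
    have h4 := Real.rpow_le_rpow (norm_nonneg _) h2 (ENNReal.toReal_nonneg (a := p))
    rw [Real.mul_rpow (norm_nonneg _) (norm_nonneg _)] at h3 h4
    have n1 : 0 ≤ ‖(T : LpUnit p →L[ℂ] LpUnit p)‖ ^ p.toReal := by positivity
    have n2 : 0 ≤ ‖(T.symm : LpUnit p →L[ℂ] LpUnit p)‖ ^ p.toReal := by positivity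
    have n3 : 0 ≤ ‖f‖ ^ p.toReal := by positivity
    have n4 : 0 ≤ ‖g‖ ^ p.toReal := by positivity
    constructor
    · refine h3.trans (mul_le_mul_of_nonneg_right ?_ n4)
      linarith
    · refine h4.trans (mul_le_mul_of_nonneg_right ?_ n3)
      linarith

theorem integral_norm_sq_twisted_trig_sum (s : Finset (Finset ℕ)) (τ : Finset ℕ → ℤ)
    (hτ : Function.Injective τ) (x : UnitIco) :
    ∫ t, ‖∑ J ∈ s, walshFun J x * trigFun (τ J) t‖ ^ 2 ∂lebIco = s.card := by
  have h := integral_norm_sq_trig_sum s (fun J => walshFun J x) τ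
  have h2 : ∀ J ∈ s, (∑ K ∈ s, walshFun J x * (starRingEnd ℂ) (walshFun K x) *
      (if τ J = τ K then 1 else 0)) = 1 := by
    intro J hJ
    rw [Finset.sum_eq_single J]
    · simp [conj_walshFun, walshFun_mul_self]
    · intro K _ hK
      rw [if_neg fun h => hK (hτ h).symm, mul_zero]
    · exact fun h => absurd hJ h
  rw [Finset.sum_congr rfl h2] at h
  simp only [Finset.sum_const, nsmul_eq_mul, mul_one] at h
  exact_mod_cast h

open scoped symmDiff in
/-- Averaging the fourth moment of a twisted trigonometric sum over the twist counts the quadruples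
that are additive for both group structures. -/
theorem le_card_of_forall_le_integral_pow_four (s : Finset (Finset ℕ)) (τ : Finset ℕ → ℤ) (B : ℝ)
    (h : ∀ x, B ≤ ∫ t, ‖∑ J ∈ s, walshFun J x * trigFun (τ J) t‖ ^ 4 ∂lebIco) :
    B ≤ ∑ q ∈ s ×ˢ s,
      (((s ×ˢ s).filter fun r => r.1 ∆ r.2 = q.1 ∆ q.2 ∧ τ r.1 - τ r.2 = τ q.1 - τ q.2).card
        : ℝ) := by
  -- The fourth moment as a Walsh polynomial in the twist x: integration in t has imposed the
  -- condition on `τ`, and integration in x will impose the one on symmetric differences.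
  set F : UnitIco → ℂ := fun x => ∑ q ∈ s ×ˢ s, ∑ r ∈ s ×ˢ s,
    walshFun ((q.1 ∆ q.2) ∆ (r.1 ∆ r.2)) x *
      (if τ q.1 - τ q.2 = τ r.1 - τ r.2 then 1 else 0) with hF
  have hF4 : ∀ x, ((∫ t, ‖∑ J ∈ s, walshFun J x * trigFun (τ J) t‖ ^ 4 ∂lebIco : ℝ) : ℂ) = F x := by
    intro x
    have h1 := integral_norm_sq_trig_sum (s ×ˢ s) (fun q => walshFun (q.1 ∆ q.2) x)
      (fun q => τ q.1 - τ q.2)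
    simp only [conj_walshFun, walshFun_mul] at h1
    rw [hF]
    simp only
    rw [← h1]
    congr 2
    ext t
    -- The square |g|² is itself a trigonometric sum indexed by pairs, so the fourth moment of g is
    -- a second moment.
    have h2 : ∑ q ∈ s ×ˢ s, walshFun (q.1 ∆ q.2) x * trigFun (τ q.1 - τ q.2) t =
        ((‖∑ J ∈ s, walshFun J x * trigFun (τ J) t‖ ^ 2 : ℝ) : ℂ) := by
      push_cast
      rw [← Complex.mul_conj', map_sum, Finset.sum_mul_sum, Finset.sum_product]
      refine Finset.sum_congr rfl fun J _ => Finset.sum_congr rfl fun K _ => ?_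
      rw [map_mul, conj_trigFun, conj_walshFun, sub_eq_add_neg, ← trigFun_mul, ← walshFun_mul]
      ring
    rw [h2, Complex.norm_real, Real.norm_of_nonneg (by positivity), ← pow_mul]
  have hFi : Integrable F lebIco := integrable_finsetSum _ fun q _ => integrable_finsetSum _
    fun r _ => (integrable_walshFun _).mul_const _
  have hI : ∫ x, F x ∂lebIco = ((∑ q ∈ s ×ˢ s, (((s ×ˢ s).filter fun r =>
      r.1 ∆ r.2 = q.1 ∆ q.2 ∧ τ r.1 - τ r.2 = τ q.1 - τ q.2).card : ℝ) : ℝ) : ℂ) := by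
    rw [hF, integral_finsetSum _ fun q _ => integrable_finsetSum _
      fun r _ => (integrable_walshFun _).mul_const _]
    push_cast
    refine Finset.sum_congr rfl fun q _ => ?_
    rw [integral_finsetSum _ fun r _ => (integrable_walshFun _).mul_const _, Finset.card_filter]
    push_cast
    refine Finset.sum_congr rfl fun r _ => ?_
    rw [integral_mul_const, integral_walshFun]
    have e1 : ((q.1 ∆ q.2) ∆ (r.1 ∆ r.2) = ∅) = (r.1 ∆ r.2 = q.1 ∆ q.2) := by
      rw [eq_comm (a := r.1 ∆ r.2)]
      exact propext symmDiff_eq_bot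
    simp only [e1, eq_comm (a := τ r.1 - τ r.2)]
    split_ifs <;> simp_all
  have hre := integral_re hFi
  rw [hI] at hre
  have hmono := integral_mono (μ := lebIco) (integrable_const B) hFi.re (fun x => by
    have := h x
    have h2 := congrArg Complex.re (hF4 x)
    rw [Complex.ofReal_re] at h2
    simpa [h2] using this)
  rw [hre] at hmono
  simpa using hmono

/-! ### The contradiction. -/

theorem theorem1p1 (p : ENNReal) [Fact (1 ≤ p)] (hp_one : 1 < p) (hp_two : p ≠ 2) (hp_top : p < ⊤)
    (σ : trigFunctions → walshFunctions) (hσ : Function.Bijective σ) :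
    ¬ ExtendsToIsomorphism p σ := by
  classical
  intro hext
  obtain ⟨τ, hτ, C, hC, hcomp⟩ := hext.exists_integral_comparison hp_top.ne hσ
  have hq1 : 1 < p.toReal := by
    have := (ENNReal.toReal_lt_toReal ENNReal.one_ne_top hp_top.ne).2 hp_one
    rwa [ENNReal.toReal_one] at this
  have hq2 : p.toReal ≠ 2 := by
    intro h
    apply hp_two
    rw [← ENNReal.ofReal_toReal hp_top.ne, h]
    norm_num
  set q := p.toReal with hq
  obtain ⟨c, hc, hmom⟩ := exists_le_integral_pow_four q hq1 hq2 C hC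
  -- Addition in this Boolean ring is symmetric difference, so its additive group has exponent two.
  obtain ⟨K, hK⟩ := exists_card_le_of_additive_quadruples (G := AsBoolRing (Finset ℕ))
    (fun g => symmDiff_self (ofBoolRing g)) c hc
  have hsub : ∀ g h : AsBoolRing (Finset ℕ),
      ofBoolRing (g - h) = symmDiff (ofBoolRing g) (ofBoolRing h) := fun _ _ => rfl
  have hbound : ∀ n : ℕ, (2 : ℝ) ^ n ≤ K := by
    intro n
    set s := (Finset.range n).powerset with hs
    have hcard : s.card = 2 ^ n := by rw [hs, Finset.card_powerset, Finset.card_range]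
    have hN : (0 : ℝ) < 2 ^ n := by positivity
    have h4 : ∀ x, c * (2 ^ n : ℝ) ^ 3 ≤
        ∫ t, ‖∑ J ∈ s, walshFun J x * trigFun (τ J) t‖ ^ 4 ∂lebIco := by
      intro x
      let g : UnitIco → ℂ := fun t => ∑ J ∈ s, walshFun J x * trigFun (τ J) t
      have hg : Continuous g :=
        continuous_finsetSum _ fun J _ => continuous_const.mul (continuous_trigFun _)
      have hgN : ∀ t, ‖g t‖ ≤ 2 ^ n := by
        intro t
        refine (norm_sum_le _ _).trans ?_
        simp only [norm_mul, norm_walshFun, norm_trigFun, mul_one, Finset.sum_const, hcard,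
          nsmul_eq_mul]
        push_cast
        rfl
      have hg2 : ∫ t, ‖g t‖ ^ 2 ∂lebIco = 2 ^ n := by
        have := integral_norm_sq_twisted_trig_sum s τ hτ x
        rw [hcard] at this
        push_cast at this
        exact this
      have hgq := hcomp s (fun J => walshFun J x)
      rw [integral_norm_rpow_walsh_kernel q (by linarith) n x] at hgq
      have hNq : (0 : ℝ) < (2 ^ n : ℝ) ^ q := by positivity
      -- After division by N = 2^n, the second moment is N/N² = 1/N and the kernel's `q`-th moment
      -- is N^(q-1)/N^q = 1/N, so the comparison constant is exactly `C`.
      have key := hmom lebIco (fun t => ‖g t‖ / 2 ^ n) (1 / 2 ^ n)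
        ((hg.norm.div_const _).aestronglyMeasurable) (fun t => by positivity)
        (fun t => (div_le_one hN).2 (hgN t))
        (by simp only [div_pow, integral_div, hg2]; field_simp)
        (by
          simp only [Real.div_rpow (norm_nonneg _) hN.le, integral_div]
          rw [div_le_iff₀ hNq]
          refine hgq.2.trans_eq ?_
          ring)
        (by
          simp only [Real.div_rpow (norm_nonneg _) hN.le, integral_div]
          rw [← mul_div_assoc, le_div_iff₀ hNq]
          refine le_trans (le_of_eq ?_) hgq.1
          ring)
      simp only [div_pow, integral_div] at key
      rw [le_div_iff₀ (by positivity)] at key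
      refine le_trans (le_of_eq ?_) key
      field_simp
    have hcount := le_card_of_forall_le_integral_pow_four s τ _ h4
    have := hK (s.map toBoolRing.toEmbedding) (fun g => τ (ofBoolRing g))
      (hτ.comp ofBoolRing.injective) (by
        rw [Finset.card_map, hcard]
        push_cast
        refine hcount.trans_eq ?_
        simp only [Finset.card_filter, Finset.sum_product, Finset.sum_map, Equiv.coe_toEmbedding,
          ofBoolRing_toBoolRing, ← ofBoolRing_inj (α := Finset ℕ), hsub]
        congr!)
    rw [Finset.card_map, hcard] at this
    push_cast at this
    exact this
  obtain ⟨n, hn⟩ := pow_unbounded_of_one_lt K (one_lt_two (α := ℝ))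
  exact absurd (hbound n) (not_le.2 hn)
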